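/- Let $X$ be a locally compact, connected Hausdorff space. A deficient topological measure on $X$ is a set function $\mu$ from the open and closed subsets of $X$ to $[0,\infty]$, not identically $\infty$, such that $\mu(C\sqcup K)=\mu(C)+\mu(K)$ for disjoint compact $C,K$; $\mu(U)=\sup\{\mu(K):K\subseteq U,\ K\text{ compact}\}$ for $U$ open; $\mu(F)=\inf\{\mu(U):F\subseteq U,\ U\text{ open}\}$ for $F$ closed. It is a topological measure if, in addition, $\mu(A\sqcup B)=\mu(A)+\mu(B)$ for disjoint $A,B$ whenever each of $A$, $B$, $A\sqcup B$ is compact or open. It is finite if $\mu(X)<\infty$. For a finite deficient topological measure $\mu$ and a bounded continuous $f:X\to\mathbb R$ put $R_1(t)=\mu(f^{-1}((t,\infty)))$, let $r=r_{\mu,f}$ be the Lebesgue–Stieltjes measure on $\mathbb R$ associated with $-R_1$, and let $\int_X f\,d\mu=\int_{\mathbb R}\mathrm{id}\,dr$. For $A\subseteq X$ open or closed let $\int_A f\,d\mu=\int_X f\,d\mu_A$, where $\mu_A$ is the restricted deficient topological measure: if $A$ is open, $\mu_A(U)=\mu(U\cap A)$ for $U$ open and $\mu_A(F)=\inf\{\mu_A(U):F\subseteq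 U,\ U\text{ open}\}$ for $F$ closed; if $A$ is closed, $\mu_A(K)=\mu(A\cap K)$ for $K$ compact, $\mu_A(U)=\sup\{\mu_A(K):K\subseteq U,\ K\text{ compact}\}$ for $U$ open, and $\mu_A(F)=\inf\{\mu_A(U):F\subseteq U,\ U\text{ open}\}$ for $F$ closed. Put $\mu_g(A)=\int_A g\,d\mu$ for $g\in C_0^+(X)$ (nonnegative continuous functions vanishing at infinity), and, for $X$ compact and $g\in C(X)$, $\nu_g(A)=\int_A g\,d\mu$ (so $\nu_g=\mu_g$ if $g\ge 0$). In either case let $n_r$ be the measure on the $\sigma$-algebra $\{g^{-1}(B):B\subseteq\mathbb R\text{ Borel}\}$ of subsets of $X$ with $n_r(g^{-1}(B))=r_{\mu,g}(B)$. **Theorem.** Let $\mu$ be a finite deficient topological measure on $X$ and let $g\in C_0^+(X)$. Then (i) $\mu_g(E)\le\int_E g\,dn_r$ for $E=g^{-1}(A)$, where $A\subseteq\mathbb R$ is open or closed. (ii) $\mu_g(g^{-1}(\{0\}))=\int_{g^{-1}(\{0\})}g\,dn_r=0$, and $\mu_g(E)=\int_E g\,dn_r=0$ for $E=g^{-1}(A)$,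 where $A\subseteq(-\infty,0)$ is open or closed. (iii) If $\mu$ is a topological measure, then $\mu_g(E)=\int_E g\,dn_r$ for $E=g^{-1}(A)$, where $A\subseteq\mathbb R\setminus\{0\}$ is closed (in $\mathbb R$) or $A\subseteq\mathbb R$ is open. (iv) If $X$ is compact and $\mu$ is a topological measure, then for every $g\in C(X)$, $\nu_g(E)=\int_E g\,dn_r$ for $E=g^{-1}(A)$, where $A\subseteq\mathbb R$ is open or closed. (v) If $X$ is compact, then $\mu$ is a topological measure if and only if $\mu_g(E)=\int_E g\,dn_r$ for every nonnegative $g\in C(X)$ and every $E=g^{-1}(C)$ with $C\subseteq\mathbb R$ closed. -/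

import Mathlib

open Set MeasureTheory
open scoped ENNReal ZeroAtInfty

noncomputable section

namespace DTM

theorem comap_le_caratheodory {X : Type*} (g : X → ℝ) (r : Measure ℝ) :
    MeasurableSpace.comap g (borel ℝ) ≤ (OuterMeasure.comap g r.toOuterMeasure).caratheodory := by
  rintro _ ⟨B, hB, rfl⟩ S
  have hB' : MeasurableSet B := by rwa [BorelSpace.measurable_eq (α := ℝ)]
  simp only [OuterMeasure.comap_apply, image_inter_preimage, image_sdiff_preimage]
  exact (measure_inter_add_sdiff (g '' S) hB').symm

/-- The measure on the `σ`-algebra `{g⁻¹(B) : B Borel}` of subsets of `X` pulled back from `r`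
along `g`, `E ↦ r(g(E))`. -/
def pullback {X : Type*} (g : X → ℝ) (r : Measure ℝ) : @Measure X (MeasurableSpace.comap g (borel ℝ)) :=
  @OuterMeasure.toMeasure X (MeasurableSpace.comap g (borel ℝ))
    (OuterMeasure.comap g r.toOuterMeasure) (comap_le_caratheodory g r)

/-- If `r` does not charge the complement of the range of `g`, the pulled back measure is the one
with `n(g⁻¹(B)) = r(B)` for all Borel sets `B`. -/
theorem pullback_preimage {X : Type*} (g : X → ℝ) (r : Measure ℝ) (hr : r (range g)ᶜ = 0) (B : Set ℝ)
    (hB : MeasurableSet B) : pullback g r (g ⁻¹' B) = r B := by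
  have hB' : MeasurableSet[MeasurableSpace.comap g (borel ℝ)] (g ⁻¹' B) :=
    ⟨B, by rwa [BorelSpace.measurable_eq (α := ℝ)] at hB, rfl⟩
  rw [pullback, @toMeasure_apply X (MeasurableSpace.comap g (borel ℝ)) _ _ _ hB', OuterMeasure.comap_apply, image_preimage_eq_inter_range]
  exact measure_inter_conull hr

variable {X : Type*} [TopologicalSpace X]

/-- A deficient topological measure: a `[0, ∞]`-valued set function on the open and the closed
subsets of `X` (the values of `ν` on other sets play no role) which is finitely additive on
compact sets, inner compact regular on open sets, outer regular on closed sets, and not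
identically `∞`. -/
structure IsDeficientTopologicalMeasure (ν : Set X → ℝ≥0∞) : Prop where
  exists_ne_top : ∃ A, (IsOpen A ∨ IsClosed A) ∧ ν A ≠ ∞
  union_compact : ∀ C K, IsCompact C → IsCompact K → Disjoint C K → ν (C ∪ K) = ν C + ν K
  inner_regular : ∀ U, IsOpen U → ν U = ⨆ (K : Set X) (_ : IsCompact K) (_ : K ⊆ U), ν K
  outer_regular : ∀ F, IsClosed F → ν F = ⨅ (U : Set X) (_ : IsOpen U) (_ : F ⊆ U), ν U

/-- A topological measure: additive on disjoint sets `A`, `B` such that each of `A`, `B`, `A ∪ B`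
is compact or open, inner compact regular on open sets, outer regular on closed sets, and not
identically `∞`. -/
structure IsTopologicalMeasure (ν : Set X → ℝ≥0∞) : Prop where
  exists_ne_top : ∃ A, (IsOpen A ∨ IsClosed A) ∧ ν A ≠ ∞
  union : ∀ A B, (IsCompact A ∨ IsOpen A) → (IsCompact B ∨ IsOpen B) →
    (IsCompact (A ∪ B) ∨ IsOpen (A ∪ B)) → Disjoint A B → ν (A ∪ B) = ν A + ν B
  inner_regular : ∀ U, IsOpen U → ν U = ⨆ (K : Set X) (_ : IsCompact K) (_ : K ⊆ U), ν K
  outer_regular : ∀ F, IsClosed F → ν F = ⨅ (U : Set X) (_ : IsOpen U) (_ : F ⊆ U), ν U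

open Classical in
/-- The restriction `μ_V` of `μ` to an open set `V`: `μ_V(U) = μ(U ∩ V)` for `U` open, and
`μ_V(F) = inf {μ_V(U) : F ⊆ U, U open}` for `F` closed. -/
def restrictOpen (μ : Set X → ℝ≥0∞) (V : Set X) : Set X → ℝ≥0∞ := fun B =>
  if IsOpen B then μ (B ∩ V) else ⨅ (U : Set X) (_ : IsOpen U) (_ : B ⊆ U), μ (U ∩ V)

open Classical in
/-- The restriction `μ_F` of `μ` to a closed set `F`: `μ_F(K) = μ(F ∩ K)` for `K` compact,
`μ_F(U) = sup {μ_F(K) : K ⊆ U, K compact}` for `U` open, and on the remaining closed sets the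
value dictated by outer regularity. -/
def restrictClosed (μ : Set X → ℝ≥0∞) (F : Set X) : Set X → ℝ≥0∞ := fun B =>
  if IsCompact B then μ (F ∩ B)
  else if IsOpen B then ⨆ (K : Set X) (_ : IsCompact K) (_ : K ⊆ B), μ (F ∩ K)
  else ⨅ (U : Set X) (_ : IsOpen U) (_ : B ⊆ U),
    ⨆ (K : Set X) (_ : IsCompact K) (_ : K ⊆ U), μ (F ∩ K)

open Classical in
/-- The restriction `μ_A` of `μ` to an open or closed set `A` (the two recipes agree when `A` is
both open and closed and `μ` is a deficient topological measure). -/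
def restrict (μ : Set X → ℝ≥0∞) (A : Set X) : Set X → ℝ≥0∞ :=
  if IsOpen A then restrictOpen μ A else restrictClosed μ A

/-- The distribution function `R₁(t) = μ(f⁻¹((t, ∞)))`. -/
def distr (μ : Set X → ℝ≥0∞) (f : X → ℝ) (t : ℝ) : ℝ :=
  (μ (f ⁻¹' Ioi t)).toReal

open Classical in
/-- The Lebesgue-Stieltjes measure `r` associated with `-R₁`. (For `f` continuous and `μ` a finite
deficient topological measure, `-R₁` is nondecreasing and right-continuous; the value `0` in the
other case is a mere convention.) -/
def stieltjes (μ : Set X → ℝ≥0∞) (f : X → ℝ) : Measure ℝ :=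
  if h : Monotone (fun t => -distr μ f t) then h.stieltjesFunction.measure else 0

/-- The quasi-integral `∫_X f dμ = ∫_ℝ id dr`. -/
def quasiIntegral (μ : Set X → ℝ≥0∞) (f : X → ℝ) : ℝ :=
  ∫ t, t ∂(stieltjes μ f)

/-- The set function `A ↦ ∫_A g dμ = ∫_X g dμ_A` on open and closed sets `A`, written `μ_g`
(for `g ≥ 0` vanishing at infinity) or `ν_g` (for `X` compact and `g` continuous). -/
def integralOver (μ : Set X → ℝ≥0∞) (g : X → ℝ) (A : Set X) : ℝ :=
  quasiIntegral (restrict μ A) g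

/-- The measure `n_r` of `g`, on the `σ`-algebra `{g⁻¹(B) : B Borel}` of subsets of `X`,
`n_r(g⁻¹(B)) = r(B)`, where `r` is the Lebesgue-Stieltjes measure associated with the
distribution function `R₁` of `g` with respect to `μ`. -/
def nMeasure (μ : Set X → ℝ≥0∞) (g : X → ℝ) : @Measure X (MeasurableSpace.comap g (borel ℝ)) :=
  pullback g (stieltjes μ g)

end DTM

end

/-!
The inner content `μ_*(B) = sup {μ(K) : K ⊆ B, K compact}` is superadditive on disjoint sets, and
`μ_E(U) = μ_*(U ∩ E)` for `U` open, whether `E` is open or closed. Hence, for `E = g⁻¹(A)`, the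
measure `ρ` with `∫_E g dμ = ∫ id dρ` satisfies `ρ((t, ∞)) = μ_*(g⁻¹(A ∩ (t, ∞)))`, while
`∫_E g dn_r = ∫ id dσ` for `σ = r|_A`, with `σ((t, ∞)) = r(A ∩ (t, ∞))`. Superadditivity gives
`μ_*(g⁻¹(B)) ≤ r(B)`, first for half-open intervals, then for open sets by splitting them into
components, and for all `B` by outer regularity of `r`; the layer-cake formula turns this into the
inequality of integrals. If `μ` is a topological measure and `g⁻¹(L)` is compact, additivity on
`X = g⁻¹(L) ∪ g⁻¹(Lᶜ)` reverses the inequality at `L`, and inner regularity of `r` at every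
Borel set all of whose compact subsets `L` have this property.

Conversely, if `g ≥ 1` then both integrals over `g⁻¹({1})` are masses, and their equality says
`μ(X) ≤ μ(g⁻¹({1})) + μ(g⁻¹((1, ∞)))`. Urysohn functions `g = 1 + f` turn this into
`μ(X) ≤ μ(U) + μ(Uᶜ)` for all open `U`, which is the only instance of additivity that a finite
deficient topological measure on a compact space can lack.
-/

namespace DTM

section

open Filter Topology

variable {X : Type*} [TopologicalSpace X] {μ : Set X → ℝ≥0∞} {g : X → ℝ}

/-! ### Inner content -/

/-- The inner content `μ_*(B) = sup {μ(K) : K ⊆ B, K compact}` of an arbitrary set `B`, which agrees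
with a deficient topological measure `μ` on open sets and on compact closed sets. -/
noncomputable def innerContent (μ : Set X → ℝ≥0∞) (B : Set X) : ℝ≥0∞ :=
  ⨆ (K : Set X) (_ : IsCompact K) (_ : K ⊆ B), μ K

theorem le_innerContent {K B : Set X} (hK : IsCompact K) (h : K ⊆ B) : μ K ≤ innerContent μ B :=
  le_iSup₂_of_le K hK (le_iSup_of_le h le_rfl)

theorem innerContent_le_iff {B : Set X} {c : ℝ≥0∞} :
    innerContent μ B ≤ c ↔ ∀ K, IsCompact K → K ⊆ B → μ K ≤ c := by
  simp only [innerContent, iSup_le_iff]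

theorem lt_innerContent_iff {B : Set X} {c : ℝ≥0∞} :
    c < innerContent μ B ↔ ∃ K, IsCompact K ∧ K ⊆ B ∧ c < μ K := by
  simp only [innerContent, lt_iSup_iff, exists_prop]

theorem innerContent_mono {A B : Set X} (h : A ⊆ B) : innerContent μ A ≤ innerContent μ B :=
  innerContent_le_iff.2 fun _ hK hKA => le_innerContent hK (hKA.trans h)

/-! ### Deficient topological measures -/

theorem IsTopologicalMeasure.isDeficientTopologicalMeasure (hτ : IsTopologicalMeasure μ) :
    IsDeficientTopologicalMeasure μ where
  exists_ne_top := hτ.exists_ne_top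
  union_compact C K hC hK := hτ.union C K (.inl hC) (.inl hK) (.inl (hC.union hK))
  inner_regular := hτ.inner_regular
  outer_regular := hτ.outer_regular

namespace IsDeficientTopologicalMeasure

theorem innerContent_eq_of_isOpen (hμ : IsDeficientTopologicalMeasure μ) {U : Set X}
    (hU : IsOpen U) : innerContent μ U = μ U :=
  (hμ.inner_regular U hU).symm

theorem le_of_isCompact (hμ : IsDeficientTopologicalMeasure μ) {K B : Set X} (hK : IsCompact K)
    (hB : IsOpen B ∨ IsClosed B) (h : K ⊆ B) : μ K ≤ μ B := by
  have le_open {U : Set X} (hU : IsOpen U) (hKU : K ⊆ U) : μ K ≤ μ U :=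
    (le_innerContent hK hKU).trans_eq (hμ.innerContent_eq_of_isOpen hU)
  rcases hB with hB | hB
  · exact le_open hB h
  · rw [hμ.outer_regular B hB]
    exact le_iInf₂ fun U hU => le_iInf fun hBU => le_open hU (h.trans hBU)

theorem innerContent_eq_of_isCompact (hμ : IsDeficientTopologicalMeasure μ) {K : Set X}
    (hK : IsCompact K) (hK' : IsClosed K) : innerContent μ K = μ K :=
  le_antisymm (innerContent_le_iff.2 fun _ hC hCK => hμ.le_of_isCompact hC (.inr hK') hCK)
    (le_innerContent hK subset_rfl)

theorem innerContent_le (hμ : IsDeficientTopologicalMeasure μ) {A B : Set X}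
    (hB : IsOpen B ∨ IsClosed B) (h : A ⊆ B) : innerContent μ A ≤ μ B :=
  innerContent_le_iff.2 fun _ hK hKA => hμ.le_of_isCompact hK hB (hKA.trans h)

theorem mono (hμ : IsDeficientTopologicalMeasure μ) {A B : Set X} (hA : IsOpen A ∨ IsClosed A)
    (hB : IsOpen B ∨ IsClosed B) (h : A ⊆ B) : μ A ≤ μ B := by
  rcases hA with hA | hA
  · exact (hμ.innerContent_eq_of_isOpen hA).symm.trans_le (hμ.innerContent_le hB h)
  have le_open {U : Set X} (hU : IsOpen U) (hAU : A ⊆ U) : μ A ≤ μ U := by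
    rw [hμ.outer_regular A hA]
    exact iInf₂_le_of_le U hU (iInf_le_of_le hAU le_rfl)
  rcases hB with hB | hB
  · exact le_open hB h
  · rw [hμ.outer_regular B hB]
    exact le_iInf₂ fun U hU => le_iInf fun hBU => le_open hU (h.trans hBU)

theorem ne_top (hμ : IsDeficientTopologicalMeasure μ) (hfin : μ univ < ∞) {A : Set X}
    (hA : IsOpen A ∨ IsClosed A) : μ A ≠ ∞ :=
  ((hμ.mono hA (.inl isOpen_univ) (subset_univ A)).trans_lt hfin).ne

theorem empty (hμ : IsDeficientTopologicalMeasure μ) : μ ∅ = 0 := by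
  obtain ⟨A, hA, hAtop⟩ := hμ.exists_ne_top
  have hne : μ ∅ ≠ ∞ := ne_top_of_le_ne_top hAtop (hμ.mono (.inl isOpen_empty) hA (empty_subset A))
  have h : μ ∅ = μ ∅ + μ ∅ := by
    simpa only [union_empty] using
      hμ.union_compact ∅ ∅ isCompact_empty isCompact_empty (disjoint_empty ∅)
  exact (ENNReal.add_right_inj hne).1 (by rw [add_zero, ← h])

theorem exists_isOpen_lt (hμ : IsDeficientTopologicalMeasure μ) {F : Set X} (hF : IsClosed F)
    {c : ℝ≥0∞} (hc : μ F < c) : ∃ U, IsOpen U ∧ F ⊆ U ∧ μ U < c := by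
  rw [hμ.outer_regular F hF] at hc
  simpa only [iInf_lt_iff, exists_prop] using hc

theorem exists_isCompact_le_add (hμ : IsDeficientTopologicalMeasure μ) {U : Set X} (hU : IsOpen U)
    (hUtop : μ U ≠ ∞) {ε : ℝ≥0∞} (hε : ε ≠ 0) : ∃ K, IsCompact K ∧ K ⊆ U ∧ μ U ≤ μ K + ε := by
  rcases eq_or_ne (μ U) 0 with hU0 | hU0
  · exact ⟨∅, isCompact_empty, empty_subset U, hU0.trans_le zero_le⟩
  have h : μ U - ε < innerContent μ U :=
    (ENNReal.sub_lt_self hUtop hU0 hε).trans_eq (hμ.innerContent_eq_of_isOpen hU).symm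
  obtain ⟨K, hK, hKU, hμK⟩ := lt_innerContent_iff.1 h
  exact ⟨K, hK, hKU, tsub_le_iff_right.1 hμK.le⟩

theorem innerContent_add_le (hμ : IsDeficientTopologicalMeasure μ) {A B : Set X}
    (hd : Disjoint A B) : innerContent μ A + innerContent μ B ≤ innerContent μ (A ∪ B) := by
  simp only [innerContent, iSup_and']
  refine ENNReal.biSup_add_biSup_le' ⟨∅, isCompact_empty, empty_subset A⟩
    ⟨∅, isCompact_empty, empty_subset B⟩ fun K hK C hC => ?_
  rw [← hμ.union_compact K C hK.1 hC.1 (hd.mono hK.2 hC.2)]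
  exact le_iSup₂_of_le (K ∪ C) ⟨hK.1.union hC.1, union_subset_union hK.2 hC.2⟩ le_rfl

theorem innerContent_union (hμ : IsDeficientTopologicalMeasure μ) {A B : Set X}
    (h : SeparatedNhds A B) : innerContent μ (A ∪ B) = innerContent μ A + innerContent μ B := by
  refine le_antisymm (innerContent_le_iff.2 fun K hK hKAB => ?_) (hμ.innerContent_add_le h.disjoint)
  obtain ⟨U, V, hU, hV, hAU, hBV, hUV⟩ := h
  have hKVA : K \ V ⊆ A := fun x hx => (hKAB hx.1).resolve_right fun hxB => hx.2 (hBV hxB)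
  have hKUB : K \ U ⊆ B := fun x hx => (hKAB hx.1).resolve_left fun hxA => hx.2 (hAU hxA)
  have hKeq : (K \ V) ∪ (K \ U) = K := by rw [← sdiff_inter, hUV.symm.inter_eq, sdiff_empty]
  calc μ K = μ (K \ V) + μ (K \ U) := by
        conv_lhs => rw [← hKeq]
        exact hμ.union_compact _ _ (hK.diff hV) (hK.diff hU)
          (hUV.mono (hKVA.trans hAU) (hKUB.trans hBV))
    _ ≤ innerContent μ A + innerContent μ B :=
        add_le_add (le_innerContent (hK.diff hV) hKVA) (le_innerContent (hK.diff hU) hKUB)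

theorem union_of_isOpen (hμ : IsDeficientTopologicalMeasure μ) {U V : Set X} (hU : IsOpen U)
    (hV : IsOpen V) (hd : Disjoint U V) : μ (U ∪ V) = μ U + μ V := by
  simpa only [hμ.innerContent_eq_of_isOpen, hU, hV, hU.union hV] using
    hμ.innerContent_union ⟨U, V, hU, hV, subset_rfl, subset_rfl, hd⟩

theorem biUnion_finset_of_isOpen (hμ : IsDeficientTopologicalMeasure μ) {ι : Type*}
    {s : Finset ι} {U : ι → Set X} (hU : ∀ i ∈ s, IsOpen (U i))
    (hd : (s : Set ι).PairwiseDisjoint U) : μ (⋃ i ∈ s, U i) = ∑ i ∈ s, μ (U i) := by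
  classical
  induction s using Finset.induction_on with
  | empty => simpa using hμ.empty
  | insert i s his ih =>
    simp only [Finset.mem_insert, forall_eq_or_imp] at hU
    rw [Finset.coe_insert, pairwiseDisjoint_insert_of_notMem (by simpa using his)] at hd
    rw [Finset.set_biUnion_insert, Finset.sum_insert his, ← ih hU.2 hd.1]
    exact hμ.union_of_isOpen hU.1 (isOpen_biUnion hU.2) (disjoint_iUnion₂_right.2 hd.2)

theorem tendsto_of_eventually_subset (hμ : IsDeficientTopologicalMeasure μ) {ι : Type*}
    {l : Filter ι} {V : ι → Set X} {U : Set X} (hU : IsOpen U) (hV : ∀ i, IsOpen (V i))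
    (hVU : ∀ᶠ i in l, V i ⊆ U) (h : ∀ K, IsCompact K → K ⊆ U → ∀ᶠ i in l, K ⊆ V i) :
    Tendsto (fun i => μ (V i)) l (𝓝 (μ U)) := by
  refine tendsto_order.2 ⟨fun c hc => ?_, fun c hc => ?_⟩
  · rw [← hμ.innerContent_eq_of_isOpen hU, lt_innerContent_iff] at hc
    obtain ⟨K, hK, hKU, hcK⟩ := hc
    filter_upwards [h K hK hKU] with i hi
    exact hcK.trans_le (hμ.le_of_isCompact hK (.inl (hV i)) hi)
  · filter_upwards [hVU] with i hi
    exact (hμ.mono (.inl (hV i)) (.inl hU) hi).trans_lt hc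

end IsDeficientTopologicalMeasure

/-! ### Restrictions -/

theorem iSup_inter_eq_innerContent {E : Set X} (hE : IsClosed E) (B : Set X) :
    ⨆ (K : Set X) (_ : IsCompact K) (_ : K ⊆ B), μ (E ∩ K) = innerContent μ (B ∩ E) := by
  refine le_antisymm (iSup₂_le fun K hK => iSup_le fun hKB => ?_)
    (innerContent_le_iff.2 fun K hK hKBE => ?_)
  · exact le_innerContent (hK.inter_left hE) fun x hx => ⟨hKB hx.2, hx.1⟩
  · refine le_iSup₂_of_le K hK (le_iSup_of_le (hKBE.trans inter_subset_left) ?_)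
    rw [inter_eq_self_of_subset_right (hKBE.trans inter_subset_right)]

namespace IsDeficientTopologicalMeasure

theorem restrict_eq_innerContent [T2Space X] (hμ : IsDeficientTopologicalMeasure μ) {E U : Set X}
    (hE : IsOpen E ∨ IsClosed E) (hU : IsOpen U) : restrict μ E U = innerContent μ (U ∩ E) := by
  by_cases hEo : IsOpen E
  · rw [restrict, if_pos hEo, restrictOpen, if_pos hU,
      hμ.innerContent_eq_of_isOpen (hU.inter hEo)]
  · have hEc := hE.resolve_left hEo
    rw [restrict, if_neg hEo, restrictClosed]
    split_ifs with hUc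
    · have hEU := hUc.inter_left hEc
      rw [inter_comm E U] at hEU ⊢
      rw [hμ.innerContent_eq_of_isCompact hEU hEU.isClosed]
    · exact iSup_inter_eq_innerContent hEc U

theorem restrict_eq_iInf_innerContent [T2Space X] (hμ : IsDeficientTopologicalMeasure μ)
    {E F : Set X} (hE : IsOpen E ∨ IsClosed E) (hF : IsClosed F) :
    restrict μ E F = ⨅ (U : Set X) (_ : IsOpen U) (_ : F ⊆ U), innerContent μ (U ∩ E) := by
  by_cases hFo : IsOpen F
  · rw [hμ.restrict_eq_innerContent hE hFo]
    exact le_antisymm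
      (le_iInf₂ fun U _ => le_iInf fun hFU => innerContent_mono (inter_subset_inter_left E hFU))
      (iInf₂_le_of_le F hFo (iInf_le_of_le subset_rfl le_rfl))
  by_cases hEo : IsOpen E
  · rw [restrict, if_pos hEo, restrictOpen, if_neg hFo]
    exact iInf_congr fun U => iInf_congr fun hU => by
      rw [hμ.innerContent_eq_of_isOpen (hU.inter hEo)]
  have hEc := hE.resolve_left hEo
  rw [restrict, if_neg hEo, restrictClosed, if_neg hFo]
  split_ifs with hFc
  · refine le_antisymm (le_iInf₂ fun U _ => le_iInf fun hFU => ?_) (le_of_forall_gt fun c hc => ?_)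
    · exact le_innerContent (hFc.inter_left hEc) fun x hx => ⟨hFU hx.2, hx.1⟩
    · -- `V ∪ Eᶜ` is a neighbourhood of `F` whose trace on `E` is no larger than `V ⊇ E ∩ F`.
      obtain ⟨V, hV, hEFV, hVc⟩ := hμ.exists_isOpen_lt (hEc.inter hF) hc
      have hFV : F ⊆ V ∪ Eᶜ := fun x hx => (em (x ∈ E)).imp (fun hxE => hEFV ⟨hxE, hx⟩) id
      refine (iInf₂_le_of_le (V ∪ Eᶜ) (hV.union hEc.isOpen_compl)
        (iInf_le_of_le hFV ?_)).trans_lt hVc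
      exact hμ.innerContent_le (.inl hV) fun x hx => hx.1.resolve_right (not_not.2 hx.2)
  · simp only [iSup_inter_eq_innerContent hEc]

theorem restrict_union_of_isCompact [T2Space X] (hμ : IsDeficientTopologicalMeasure μ)
    {E C K : Set X} (hE : IsOpen E ∨ IsClosed E) (hC : IsCompact C) (hK : IsCompact K)
    (hd : Disjoint C K) : restrict μ E (C ∪ K) = restrict μ E C + restrict μ E K := by
  obtain ⟨U, V, hU, hV, hCU, hKV, hUV⟩ := SeparatedNhds.of_isCompact_isCompact hC hK hd
  have restrict_le {F W : Set X} (hF : IsCompact F) (hW : IsOpen W) (hFW : F ⊆ W) :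
      restrict μ E F ≤ innerContent μ (W ∩ E) := by
    rw [hμ.restrict_eq_iInf_innerContent hE hF.isClosed]
    exact iInf₂_le_of_le W hW (iInf_le_of_le hFW le_rfl)
  apply le_antisymm
  · rw [hμ.restrict_eq_iInf_innerContent hE hC.isClosed,
      hμ.restrict_eq_iInf_innerContent hE hK.isClosed]
    simp only [iInf_and']
    refine ENNReal.le_iInf₂_add_iInf₂ fun P hP Q hQ => ?_
    calc restrict μ E (C ∪ K) ≤ innerContent μ ((P ∩ U ∪ Q ∩ V) ∩ E) :=
          restrict_le (hC.union hK) ((hP.1.inter hU).union (hQ.1.inter hV))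
            (union_subset_union (subset_inter hP.2 hCU) (subset_inter hQ.2 hKV))
      _ = innerContent μ (P ∩ U ∩ E) + innerContent μ (Q ∩ V ∩ E) := by
          rw [union_inter_distrib_right]
          exact hμ.innerContent_union ⟨U, V, hU, hV, fun x hx => hx.1.2, fun x hx => hx.1.2, hUV⟩
      _ ≤ innerContent μ (P ∩ E) + innerContent μ (Q ∩ E) :=
          add_le_add (innerContent_mono (inter_subset_inter_left E inter_subset_left))
            (innerContent_mono (inter_subset_inter_left E inter_subset_left))
  · rw [hμ.restrict_eq_iInf_innerContent hE (hC.union hK).isClosed]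
    refine le_iInf₂ fun W hW => le_iInf fun hCKW => ?_
    obtain ⟨hCW, hKW⟩ := union_subset_iff.1 hCKW
    calc restrict μ E C + restrict μ E K
        ≤ innerContent μ (W ∩ U ∩ E) + innerContent μ (W ∩ V ∩ E) :=
          add_le_add (restrict_le hC (hW.inter hU) (subset_inter hCW hCU))
            (restrict_le hK (hW.inter hV) (subset_inter hKW hKV))
      _ ≤ innerContent μ (W ∩ U ∩ E ∪ W ∩ V ∩ E) :=
          hμ.innerContent_add_le (hUV.mono (fun x hx => hx.1.2) fun x hx => hx.1.2)
      _ ≤ innerContent μ (W ∩ E) :=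
          innerContent_mono (union_subset (inter_subset_inter_left E inter_subset_left)
            (inter_subset_inter_left E inter_subset_left))

protected theorem restrict [T2Space X] (hμ : IsDeficientTopologicalMeasure μ) {E : Set X}
    (hE : IsOpen E ∨ IsClosed E) : IsDeficientTopologicalMeasure (restrict μ E) where
  exists_ne_top := by
    refine ⟨∅, .inl isOpen_empty, ?_⟩
    rw [hμ.restrict_eq_innerContent hE isOpen_empty, empty_inter,
      hμ.innerContent_eq_of_isOpen isOpen_empty, hμ.empty]
    exact ENNReal.zero_ne_top
  union_compact C K hC hK := hμ.restrict_union_of_isCompact hE hC hK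
  inner_regular U hU := by
    rw [hμ.restrict_eq_innerContent hE hU]
    refine le_antisymm (innerContent_le_iff.2 fun K hK hKUE => ?_)
      (iSup₂_le fun K hK => iSup_le fun hKU => ?_)
    · obtain ⟨hKU, hKE⟩ := subset_inter_iff.1 hKUE
      refine le_iSup₂_of_le K hK (le_iSup_of_le hKU ?_)
      rw [hμ.restrict_eq_iInf_innerContent hE hK.isClosed]
      exact le_iInf₂ fun V _ => le_iInf fun hKV => le_innerContent hK (subset_inter hKV hKE)
    · rw [hμ.restrict_eq_iInf_innerContent hE hK.isClosed]
      exact iInf₂_le_of_le U hU (iInf_le_of_le hKU le_rfl)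
  outer_regular F hF := by
    rw [hμ.restrict_eq_iInf_innerContent hE hF]
    exact iInf_congr fun U => iInf_congr fun hU => by rw [hμ.restrict_eq_innerContent hE hU]

theorem restrict_univ_lt_top [T2Space X] (hμ : IsDeficientTopologicalMeasure μ)
    (hfin : μ univ < ∞) {E : Set X} (hE : IsOpen E ∨ IsClosed E) : restrict μ E univ < ∞ := by
  rw [hμ.restrict_eq_innerContent hE isOpen_univ]
  exact (hμ.innerContent_le (.inl isOpen_univ) (subset_univ _)).trans_lt hfin

end IsDeficientTopologicalMeasure

/-! ### The Lebesgue-Stieltjes measure of a continuous function -/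

namespace IsDeficientTopologicalMeasure

theorem monotone_neg_distr (hμ : IsDeficientTopologicalMeasure μ) (hfin : μ univ < ∞)
    (hg : Continuous g) : Monotone fun t => -distr μ g t := fun _ _ hst =>
  neg_le_neg <| ENNReal.toReal_mono (hμ.ne_top hfin (.inl (isOpen_Ioi.preimage hg))) <|
    hμ.mono (.inl (isOpen_Ioi.preimage hg)) (.inl (isOpen_Ioi.preimage hg))
      (preimage_mono (Ioi_subset_Ioi hst))

theorem tendsto_distr_nhdsGT (hμ : IsDeficientTopologicalMeasure μ) (hfin : μ univ < ∞)
    (hg : Continuous g) (t : ℝ) : Tendsto (distr μ g) (𝓝[>] t) (𝓝 (distr μ g t)) := by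
  refine (ENNReal.tendsto_toReal (hμ.ne_top hfin (.inl (isOpen_Ioi.preimage hg)))).comp ?_
  refine hμ.tendsto_of_eventually_subset (isOpen_Ioi.preimage hg)
    (fun s => isOpen_Ioi.preimage hg) ?_ fun K hK hKt => ?_
  · filter_upwards [self_mem_nhdsWithin] with s hs
    exact preimage_mono (Ioi_subset_Ioi (le_of_lt hs))
  · obtain ⟨u, htu, hu⟩ := hK.exists_forall_le' hg.continuousOn hKt
    filter_upwards [Ioo_mem_nhdsGT htu] with s hs x hx
    exact hs.2.trans_le (hu x hx)

theorem tendsto_distr_atBot (hμ : IsDeficientTopologicalMeasure μ) (hfin : μ univ < ∞)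
    (hg : Continuous g) : Tendsto (distr μ g) atBot (𝓝 (μ univ).toReal) := by
  refine (ENNReal.tendsto_toReal hfin.ne).comp ?_
  refine hμ.tendsto_of_eventually_subset isOpen_univ (fun s => isOpen_Ioi.preimage hg)
    (.of_forall fun s => subset_univ _) fun K hK _ => ?_
  obtain ⟨m, hm⟩ := hK.bddBelow_image hg.continuousOn
  filter_upwards [eventually_lt_atBot m] with s hs x hx
  exact hs.trans_le (hm (mem_image_of_mem g hx))

theorem tendsto_distr_atTop (hμ : IsDeficientTopologicalMeasure μ) (hfin : μ univ < ∞)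
    (hg : Continuous g) : Tendsto (distr μ g) atTop (𝓝 0) := by
  rw [← ENNReal.toReal_zero]
  refine (ENNReal.tendsto_toReal ENNReal.zero_ne_top).comp (ENNReal.tendsto_nhds_zero.2 ?_)
  intro ε hε
  obtain ⟨K, hK, -, hμK⟩ := hμ.exists_isCompact_le_add isOpen_univ hfin.ne hε.ne'
  obtain ⟨M, hM⟩ := hK.bddAbove_image hg.continuousOn
  filter_upwards [eventually_ge_atTop M] with s hs
  have hd : Disjoint K (g ⁻¹' Ioi s) :=
    disjoint_left.2 fun x hx hxs => ((hM (mem_image_of_mem g hx)).trans hs).not_gt hxs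
  have h : μ K + μ (g ⁻¹' Ioi s) ≤ μ K + ε :=
    calc μ K + μ (g ⁻¹' Ioi s) ≤ innerContent μ K + innerContent μ (g ⁻¹' Ioi s) :=
          add_le_add (le_innerContent hK subset_rfl)
            (hμ.innerContent_eq_of_isOpen (isOpen_Ioi.preimage hg)).ge
      _ ≤ innerContent μ (K ∪ g ⁻¹' Ioi s) := hμ.innerContent_add_le hd
      _ ≤ μ univ := hμ.innerContent_le (.inl isOpen_univ) (subset_univ _)
      _ ≤ μ K + ε := hμK
  have hKtop : μ K ≠ ∞ :=
    ((hμ.le_of_isCompact hK (.inl isOpen_univ) (subset_univ K)).trans_lt hfin).ne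
  exact (ENNReal.add_le_add_iff_left hKtop).1 h

theorem stieltjesFunction_eq (hμ : IsDeficientTopologicalMeasure μ) (hfin : μ univ < ∞)
    (hg : Continuous g) :
    ⇑(hμ.monotone_neg_distr hfin hg).stieltjesFunction = fun t => -distr μ g t := by
  ext t
  rw [Monotone.stieltjesFunction_eq]
  exact (hμ.monotone_neg_distr hfin hg).continuousWithinAt_Ioi_iff_rightLim_eq.1
    (hμ.tendsto_distr_nhdsGT hfin hg t).neg

theorem tendsto_stieltjesFunction_atTop (hμ : IsDeficientTopologicalMeasure μ)
    (hfin : μ univ < ∞) (hg : Continuous g) :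
    Tendsto (hμ.monotone_neg_distr hfin hg).stieltjesFunction atTop (𝓝 0) := by
  simpa only [hμ.stieltjesFunction_eq hfin hg, neg_zero] using (hμ.tendsto_distr_atTop hfin hg).neg

theorem stieltjes_Ioi (hμ : IsDeficientTopologicalMeasure μ) (hfin : μ univ < ∞)
    (hg : Continuous g) (t : ℝ) : stieltjes μ g (Ioi t) = μ (g ⁻¹' Ioi t) := by
  rw [stieltjes, dif_pos (hμ.monotone_neg_distr hfin hg),
    StieltjesFunction.measure_Ioi _ (hμ.tendsto_stieltjesFunction_atTop hfin hg),
    hμ.stieltjesFunction_eq hfin hg, zero_sub, neg_neg, distr,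
    ENNReal.ofReal_toReal (hμ.ne_top hfin (.inl (isOpen_Ioi.preimage hg)))]

theorem stieltjes_univ (hμ : IsDeficientTopologicalMeasure μ) (hfin : μ univ < ∞)
    (hg : Continuous g) : stieltjes μ g univ = μ univ := by
  have hlim : Tendsto (hμ.monotone_neg_distr hfin hg).stieltjesFunction atBot
      (𝓝 (-(μ univ).toReal)) := by
    simpa only [hμ.stieltjesFunction_eq hfin hg] using (hμ.tendsto_distr_atBot hfin hg).neg
  rw [stieltjes, dif_pos (hμ.monotone_neg_distr hfin hg),
    StieltjesFunction.measure_univ _ hlim (hμ.tendsto_stieltjesFunction_atTop hfin hg),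
    sub_neg_eq_add, zero_add, ENNReal.ofReal_toReal hfin.ne]

theorem isFiniteMeasure_stieltjes (hμ : IsDeficientTopologicalMeasure μ) (hfin : μ univ < ∞)
    (hg : Continuous g) : IsFiniteMeasure (stieltjes μ g) :=
  ⟨(hμ.stieltjes_univ hfin hg).trans_lt hfin⟩

theorem innerContent_preimage_Ioc_le (hμ : IsDeficientTopologicalMeasure μ) (hfin : μ univ < ∞)
    (hg : Continuous g) (a b : ℝ) :
    innerContent μ (g ⁻¹' Ioc a b) ≤ stieltjes μ g (Ioc a b) := by
  rcases lt_or_ge b a with hab | hab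
  · simp [Ioc_eq_empty hab.not_gt, hμ.innerContent_eq_of_isOpen isOpen_empty, hμ.empty]
  have hfinite := hμ.isFiniteMeasure_stieltjes hfin hg
  have h : innerContent μ (g ⁻¹' Ioc a b) + stieltjes μ g (Ioi b)
      ≤ stieltjes μ g (Ioc a b) + stieltjes μ g (Ioi b) := by
    have hd : Disjoint (Ioc a b) (Ioi b) := Ioc_disjoint_Ioi le_rfl
    rw [← measure_union hd measurableSet_Ioi, Ioc_union_Ioi_eq_Ioi hab, hμ.stieltjes_Ioi hfin hg,
      hμ.stieltjes_Ioi hfin hg, ← Ioc_union_Ioi_eq_Ioi hab,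
      ← hμ.innerContent_eq_of_isOpen (isOpen_Ioi.preimage hg),
      ← hμ.innerContent_eq_of_isOpen
        (((Ioc_union_Ioi_eq_Ioi hab).symm ▸ isOpen_Ioi : IsOpen (Ioc a b ∪ Ioi b)).preimage hg)]
    exact hμ.innerContent_add_le (hd.preimage g)
  exact (ENNReal.add_le_add_iff_right (measure_ne_top _ _)).1 h

theorem preimage_le_stieltjes_of_ordConnected (hμ : IsDeficientTopologicalMeasure μ)
    (hfin : μ univ < ∞) (hg : Continuous g) {I : Set ℝ} (hI : IsOpen I) (hI' : I.OrdConnected) :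
    μ (g ⁻¹' I) ≤ stieltjes μ g I := by
  rw [← hμ.innerContent_eq_of_isOpen (hI.preimage hg), innerContent_le_iff]
  intro K hK hKI
  rcases K.eq_empty_or_nonempty with rfl | hne
  · simp [hμ.empty]
  obtain ⟨x, hx, hmin⟩ := hK.exists_isMinOn hne hg.continuousOn
  obtain ⟨y, hy, hmax⟩ := hK.exists_isMaxOn hne hg.continuousOn
  obtain ⟨a, hax, haI⟩ := exists_Ioc_subset_of_mem_nhds (hI.mem_nhds (hKI hx)) ⟨g x - 1, by simp⟩
  calc μ K ≤ innerContent μ (g ⁻¹' Ioc a (g y)) :=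
        le_innerContent hK fun z hz => ⟨hax.trans_le (hmin hz), hmax hz⟩
    _ ≤ stieltjes μ g (Ioc a (g y)) := hμ.innerContent_preimage_Ioc_le hfin hg a (g y)
    _ ≤ stieltjes μ g I := measure_mono fun t ht => by
        rcases le_or_gt t (g x) with h | h
        · exact haI ⟨ht.1, h⟩
        · exact hI'.out (hKI hx) (hKI hy) ⟨h.le, ht.2⟩

theorem preimage_le_stieltjes_of_isOpen (hμ : IsDeficientTopologicalMeasure μ)
    (hfin : μ univ < ∞) (hg : Continuous g) {W : Set ℝ} (hW : IsOpen W) :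
    μ (g ⁻¹' W) ≤ stieltjes μ g W := by
  classical
  rw [← hμ.innerContent_eq_of_isOpen (hW.preimage hg), innerContent_le_iff]
  intro K hK hKW
  obtain ⟨t, -, hKt⟩ := hK.elim_nhds_subcover (fun x => g ⁻¹' connectedComponentIn W (g x))
    fun x hx => (hW.connectedComponentIn.preimage hg).mem_nhds (mem_connectedComponentIn (hKW hx))
  let T : Finset (Set ℝ) := t.image fun x => connectedComponentIn W (g x)
  have hT {I : Set ℝ} (hI : I ∈ T) : ∃ x, connectedComponentIn W (g x) = I := by
    obtain ⟨x, -, hx⟩ := Finset.mem_image.1 hI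
    exact ⟨x, hx⟩
  have hTopen : ∀ I ∈ T, IsOpen I := fun I hI => by
    obtain ⟨x, rfl⟩ := hT hI
    exact hW.connectedComponentIn
  have hTdisj : (T : Set (Set ℝ)).PairwiseDisjoint id := fun I hI J hJ hne => by
    obtain ⟨x, rfl⟩ := hT hI
    obtain ⟨y, rfl⟩ := hT hJ
    exact disjoint_left.2 fun z hzx hzy =>
      hne ((connectedComponentIn_eq hzx).trans (connectedComponentIn_eq hzy).symm)
  calc μ K ≤ μ (⋃ I ∈ T, g ⁻¹' I) :=
        hμ.le_of_isCompact hK (.inl (isOpen_biUnion fun I hI => (hTopen I hI).preimage hg))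
          (by simpa [T] using hKt)
    _ = ∑ I ∈ T, μ (g ⁻¹' I) :=
        hμ.biUnion_finset_of_isOpen (fun I hI => (hTopen I hI).preimage hg)
          fun I hI J hJ hne => (hTdisj hI hJ hne).preimage g
    _ ≤ ∑ I ∈ T, stieltjes μ g I := Finset.sum_le_sum fun I hI => by
        obtain ⟨x, rfl⟩ := hT hI
        exact hμ.preimage_le_stieltjes_of_ordConnected hfin hg hW.connectedComponentIn
          isPreconnected_connectedComponentIn.ordConnected
    _ = stieltjes μ g (⋃ I ∈ T, I) :=
        (measure_biUnion_finset hTdisj fun I hI => (hTopen I hI).measurableSet).symm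
    _ ≤ stieltjes μ g W := measure_mono <| iUnion₂_subset fun I hI => by
        obtain ⟨x, rfl⟩ := hT hI
        exact connectedComponentIn_subset W (g x)

theorem innerContent_preimage_le_stieltjes (hμ : IsDeficientTopologicalMeasure μ)
    (hfin : μ univ < ∞) (hg : Continuous g) (B : Set ℝ) :
    innerContent μ (g ⁻¹' B) ≤ stieltjes μ g B := by
  have := hμ.isFiniteMeasure_stieltjes hfin hg
  rw [B.measure_eq_iInf_isOpen]
  exact le_iInf₂ fun W hBW => le_iInf fun hW =>
    (hμ.innerContent_le (.inl (hW.preimage hg)) (preimage_mono hBW)).trans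
      (hμ.preimage_le_stieltjes_of_isOpen hfin hg hW)

theorem stieltjes_compl_range (hμ : IsDeficientTopologicalMeasure μ) (hfin : μ univ < ∞)
    (hg : Continuous g) : stieltjes μ g (range g)ᶜ = 0 := by
  have := hμ.isFiniteMeasure_stieltjes hfin hg
  refine nonpos_iff_eq_zero.1 (le_of_forall_pos_le_add fun ε hε => ?_)
  obtain ⟨K, hK, -, hμK⟩ := hμ.exists_isCompact_le_add isOpen_univ hfin.ne hε.ne'
  have hgK : MeasurableSet (g '' K) := (hK.image hg).measurableSet
  have h : stieltjes μ g (g '' K) + stieltjes μ g (g '' K)ᶜ ≤ stieltjes μ g (g '' K) + ε :=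
    calc stieltjes μ g (g '' K) + stieltjes μ g (g '' K)ᶜ = μ univ := by
          rw [measure_add_measure_compl hgK, hμ.stieltjes_univ hfin hg]
      _ ≤ μ K + ε := hμK
      _ ≤ stieltjes μ g (g '' K) + ε := add_le_add_left
          ((le_innerContent hK (subset_preimage_image g K)).trans
            (hμ.innerContent_preimage_le_stieltjes hfin hg _)) ε
  calc stieltjes μ g (range g)ᶜ ≤ stieltjes μ g (g '' K)ᶜ :=
        measure_mono (compl_subset_compl.2 (image_subset_range g K))
    _ ≤ 0 + ε := by rw [zero_add]; exact (ENNReal.add_le_add_iff_left (measure_ne_top _ _)).1 h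

theorem ae_mem_range (hμ : IsDeficientTopologicalMeasure μ) (hfin : μ univ < ∞)
    (hg : Continuous g) : ∀ᵐ t ∂(stieltjes μ g), t ∈ range g := by
  rw [ae_iff]
  exact hμ.stieltjes_compl_range hfin hg

theorem integrable_id_stieltjes (hμ : IsDeficientTopologicalMeasure μ) (hfin : μ univ < ∞)
    (hg : Continuous g) (hb : Bornology.IsBounded (range g)) :
    Integrable (fun t => t) (stieltjes μ g) := by
  have := hμ.isFiniteMeasure_stieltjes hfin hg
  obtain ⟨C, hC⟩ := hb.exists_norm_le
  refine .of_bound aestronglyMeasurable_id C ?_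
  filter_upwards [hμ.ae_mem_range hfin hg] with t ht
  exact hC t ht

end IsDeficientTopologicalMeasure

/-! ### Topological measures -/

theorem IsTopologicalMeasure.stieltjes_le_of_isCompact_preimage (hτ : IsTopologicalMeasure μ)
    (hfin : μ univ < ∞) (hg : Continuous g) {L : Set ℝ} (hL : IsClosed L)
    (hgL : IsCompact (g ⁻¹' L)) : stieltjes μ g L ≤ μ (g ⁻¹' L) := by
  have hμ := hτ.isDeficientTopologicalMeasure
  have := hμ.isFiniteMeasure_stieltjes hfin hg
  have hunion : g ⁻¹' L ∪ g ⁻¹' Lᶜ = univ := union_compl_self (g ⁻¹' L)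
  have h : stieltjes μ g L + stieltjes μ g Lᶜ ≤ μ (g ⁻¹' L) + stieltjes μ g Lᶜ :=
    calc stieltjes μ g L + stieltjes μ g Lᶜ = μ (g ⁻¹' L ∪ g ⁻¹' Lᶜ) := by
          rw [measure_add_measure_compl hL.measurableSet, hμ.stieltjes_univ hfin hg, hunion]
      _ = μ (g ⁻¹' L) + μ (g ⁻¹' Lᶜ) :=
          hτ.union _ _ (.inl hgL) (.inr (hL.isOpen_compl.preimage hg))
            (.inr (hunion ▸ isOpen_univ)) disjoint_compl_right
      _ ≤ μ (g ⁻¹' L) + stieltjes μ g Lᶜ :=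
          add_le_add_right (hμ.preimage_le_stieltjes_of_isOpen hfin hg hL.isOpen_compl) _
  exact (ENNReal.add_le_add_iff_right (measure_ne_top _ _)).1 h

theorem IsTopologicalMeasure.innerContent_preimage_eq_stieltjes (hτ : IsTopologicalMeasure μ)
    (hfin : μ univ < ∞) (hg : Continuous g) {B : Set ℝ} (hB : MeasurableSet B)
    (h : ∀ L ⊆ B, IsCompact L → IsCompact (g ⁻¹' L)) :
    innerContent μ (g ⁻¹' B) = stieltjes μ g B := by
  have hμ := hτ.isDeficientTopologicalMeasure
  have := hμ.isFiniteMeasure_stieltjes hfin hg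
  refine le_antisymm (hμ.innerContent_preimage_le_stieltjes hfin hg B)
    (le_of_forall_lt fun c hc => ?_)
  obtain ⟨L, hLB, hL, hcL⟩ := hB.exists_lt_isCompact_of_ne_top (measure_ne_top _ _) hc
  exact lt_innerContent_iff.2 ⟨g ⁻¹' L, h L hLB hL, preimage_mono hLB,
    hcL.trans_le (hτ.stieltjes_le_of_isCompact_preimage hfin hg hL.isClosed (h L hLB hL))⟩

namespace IsDeficientTopologicalMeasure

theorem union_eq_of_univ_le [CompactSpace X] (hμ : IsDeficientTopologicalMeasure μ)
    (hfin : μ univ < ∞) (h : ∀ U, IsOpen U → μ univ ≤ μ U + μ Uᶜ) {F U : Set X} (hF : IsClosed F)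
    (hU : IsOpen U) (hFU : IsClosed (F ∪ U) ∨ IsOpen (F ∪ U)) (hd : Disjoint F U) :
    μ (F ∪ U) = μ F + μ U := by
  have innerContent_eq {B : Set X} (hB : IsOpen B ∨ IsClosed B) : innerContent μ B = μ B :=
    hB.elim hμ.innerContent_eq_of_isOpen fun hB =>
      hμ.innerContent_eq_of_isCompact hB.isCompact hB
  have add_le {A B : Set X} (hA : IsOpen A ∨ IsClosed A) (hB : IsOpen B ∨ IsClosed B)
      (hAB : IsOpen (A ∪ B) ∨ IsClosed (A ∪ B)) (hd : Disjoint A B) : μ A + μ B ≤ μ (A ∪ B) := by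
    simpa only [innerContent_eq, hA, hB, hAB] using hμ.innerContent_add_le hd
  set D := (F ∪ U)ᶜ with hD
  have hD' : IsOpen D ∨ IsClosed D := hFU.imp (·.isOpen_compl) (·.isClosed_compl)
  have huniv : F ∪ U ∪ D = univ := union_compl_self (F ∪ U)
  have hle : μ (F ∪ U) + μ D ≤ μ F + μ U + μ D := by
    calc μ (F ∪ U) + μ D ≤ μ (F ∪ U ∪ D) :=
          add_le hFU.symm hD' (.inl (huniv ▸ isOpen_univ)) disjoint_compl_right
      _ = μ univ := by rw [huniv]
      _ ≤ μ F + μ U + μ D := ?_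
    rcases hFU with hFU | hFU
    · have hFc : Fᶜ = U ∪ D := by
        rw [hD, compl_union, union_inter_distrib_left, union_compl_self, inter_univ,
          union_eq_self_of_subset_left hd.symm.subset_compl_right]
      have hF' := h Fᶜ hF.isOpen_compl
      rw [compl_compl, hFc, hμ.union_of_isOpen hU hFU.isOpen_compl
        (disjoint_compl_right.mono_left subset_union_right)] at hF'
      exact hF'.trans_eq (by ring)
    · have hUc : Uᶜ = F ∪ D := by
        rw [hD, compl_union, union_inter_distrib_left, union_compl_self, univ_inter,
          union_eq_self_of_subset_left hd.subset_compl_right]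
      have hU' := h U hU
      rw [hUc, hμ.union_compact F D hF.isCompact hFU.isClosed_compl.isCompact
        (disjoint_compl_right.mono_left subset_union_left)] at hU'
      exact hU'.trans_eq (by ring)
  exact le_antisymm ((ENNReal.add_le_add_iff_right (hμ.ne_top hfin hD')).1 hle)
    (add_le (.inr hF) (.inl hU) hFU.symm hd)

theorem isTopologicalMeasure_of_univ_le [T2Space X] [CompactSpace X]
    (hμ : IsDeficientTopologicalMeasure μ) (hfin : μ univ < ∞)
    (h : ∀ U, IsOpen U → μ univ ≤ μ U + μ Uᶜ) : IsTopologicalMeasure μ where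
  exists_ne_top := hμ.exists_ne_top
  inner_regular := hμ.inner_regular
  outer_regular := hμ.outer_regular
  union A B hA hB hAB hd := by
    replace hAB := hAB.imp_left IsCompact.isClosed
    rcases hA with hA | hA <;> rcases hB with hB | hB
    · exact hμ.union_compact A B hA hB hd
    · exact hμ.union_eq_of_univ_le hfin h hA.isClosed hB hAB hd
    · rw [union_comm] at hAB ⊢
      rw [add_comm]
      exact hμ.union_eq_of_univ_le hfin h hB.isClosed hA hAB hd.symm
    · exact hμ.union_of_isOpen hA hB hd

end IsDeficientTopologicalMeasure

/-! ### Integrals over preimages -/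

theorem integral_id_le_of_measure_Ioi_le {ρ σ : Measure ℝ} (hρ : ∀ᵐ t ∂ρ, 0 ≤ t)
    (hσ : ∀ᵐ t ∂σ, 0 ≤ t) (hi : Integrable (fun t => t) σ)
    (h : ∀ t, 0 < t → ρ (Ioi t) ≤ σ (Ioi t)) : ∫ t, t ∂ρ ≤ ∫ t, t ∂σ := by
  have layercake {τ : Measure ℝ} (hτ : ∀ᵐ t ∂τ, 0 ≤ t) :
      ∫⁻ t, .ofReal t ∂τ = ∫⁻ t in Ioi 0, τ (Ioi t) :=
    lintegral_eq_lintegral_meas_lt τ hτ aemeasurable_id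
  rw [integral_eq_lintegral_of_nonneg_ae hρ aestronglyMeasurable_id,
    integral_eq_lintegral_of_nonneg_ae hσ aestronglyMeasurable_id]
  refine ENNReal.toReal_mono hi.lintegral_lt_top.ne ?_
  rw [layercake hρ, layercake hσ]
  exact setLIntegral_mono' measurableSet_Ioi h

theorem setIntegral_pullback {Y : Type*} (g : Y → ℝ) {r : Measure ℝ} (hr : r (range g)ᶜ = 0)
    {A : Set ℝ} (hA : MeasurableSet A) :
    ∫ x in g ⁻¹' A, g x ∂(pullback g r) = ∫ t in A, t ∂r := by
  borelize ℝ
  let m : MeasurableSpace Y := MeasurableSpace.comap g (borel ℝ)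
  have hgm : Measurable g := comap_measurable g
  have hmap : (pullback g r).map g = r := by
    ext B hB
    rw [Measure.map_apply hgm hB, pullback_preimage g r hr B hB]
  rw [← setIntegral_map (f := fun t : ℝ => t) hA aestronglyMeasurable_id hgm.aemeasurable, hmap]

theorem isOpen_or_isClosed_preimage {Y : Type*} [TopologicalSpace Y] {f : X → Y}
    (hf : Continuous f) {A : Set Y} (hA : IsOpen A ∨ IsClosed A) :
    IsOpen (f ⁻¹' A) ∨ IsClosed (f ⁻¹' A) :=
  hA.imp (·.preimage hf) (·.preimage hf)

theorem measurableSet_of_isOpen_or_isClosed [MeasurableSpace X] [OpensMeasurableSpace X]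
    {A : Set X} (hA : IsOpen A ∨ IsClosed A) : MeasurableSet A :=
  hA.elim IsOpen.measurableSet IsClosed.measurableSet

namespace IsDeficientTopologicalMeasure

theorem setIntegral_nMeasure (hμ : IsDeficientTopologicalMeasure μ) (hfin : μ univ < ∞)
    (hg : Continuous g) {A : Set ℝ} (hA : IsOpen A ∨ IsClosed A) :
    ∫ x in g ⁻¹' A, g x ∂(nMeasure μ g) = ∫ t in A, t ∂(stieltjes μ g) :=
  setIntegral_pullback g (hμ.stieltjes_compl_range hfin hg) (measurableSet_of_isOpen_or_isClosed hA)

theorem stieltjes_restrict_Ioi [T2Space X] (hμ : IsDeficientTopologicalMeasure μ)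
    (hfin : μ univ < ∞) (hg : Continuous g) {E : Set X} (hE : IsOpen E ∨ IsClosed E) (t : ℝ) :
    stieltjes (restrict μ E) g (Ioi t) = innerContent μ (g ⁻¹' Ioi t ∩ E) := by
  rw [(hμ.restrict hE).stieltjes_Ioi (hμ.restrict_univ_lt_top hfin hE) hg,
    hμ.restrict_eq_innerContent hE (isOpen_Ioi.preimage hg)]

theorem stieltjes_restrict_univ [T2Space X] (hμ : IsDeficientTopologicalMeasure μ)
    (hfin : μ univ < ∞) (hg : Continuous g) {E : Set X} (hE : IsOpen E ∨ IsClosed E) :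
    stieltjes (restrict μ E) g univ = innerContent μ E := by
  rw [(hμ.restrict hE).stieltjes_univ (hμ.restrict_univ_lt_top hfin hE) hg,
    hμ.restrict_eq_innerContent hE isOpen_univ, univ_inter]

theorem ae_le_stieltjes (hμ : IsDeficientTopologicalMeasure μ) (hfin : μ univ < ∞)
    (hg : Continuous g) {c : ℝ} (hc : ∀ x, c ≤ g x) : ∀ᵐ t ∂(stieltjes μ g), c ≤ t := by
  filter_upwards [hμ.ae_mem_range hfin hg] with t ht
  obtain ⟨x, rfl⟩ := ht
  exact hc x

theorem integralOver_preimage_le [T2Space X] (hμ : IsDeficientTopologicalMeasure μ)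
    (hfin : μ univ < ∞) (hg : Continuous g) (hb : Bornology.IsBounded (range g))
    (h0 : ∀ x, 0 ≤ g x) {A : Set ℝ} (hA : IsOpen A ∨ IsClosed A) :
    integralOver μ g (g ⁻¹' A) ≤ ∫ x in g ⁻¹' A, g x ∂(nMeasure μ g) := by
  have hE := isOpen_or_isClosed_preimage hg hA
  rw [hμ.setIntegral_nMeasure hfin hg hA]
  refine integral_id_le_of_measure_Ioi_le
    ((hμ.restrict hE).ae_le_stieltjes (hμ.restrict_univ_lt_top hfin hE) hg h0)
    (ae_restrict_of_ae (hμ.ae_le_stieltjes hfin hg h0))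
    (hμ.integrable_id_stieltjes hfin hg hb).integrableOn fun t _ => ?_
  rw [hμ.stieltjes_restrict_Ioi hfin hg hE, Measure.restrict_apply measurableSet_Ioi]
  exact hμ.innerContent_preimage_le_stieltjes hfin hg (Ioi t ∩ A)

theorem integralOver_preimage_of_subset_Iic [T2Space X] (hμ : IsDeficientTopologicalMeasure μ)
    (hfin : μ univ < ∞) (hg : Continuous g) {c : ℝ} (hc : ∀ x, c ≤ g x) {A : Set ℝ}
    (hA : IsOpen A ∨ IsClosed A) (hAc : A ⊆ Iic c) :
    integralOver μ g (g ⁻¹' A) = (innerContent μ (g ⁻¹' A)).toReal * c := by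
  have hE := isOpen_or_isClosed_preimage hg hA
  have hIoi : stieltjes (restrict μ (g ⁻¹' A)) g (Ioi c) = 0 := by
    rw [hμ.stieltjes_restrict_Ioi hfin hg hE, ← preimage_inter,
      ((Iic_disjoint_Ioi le_rfl).mono_left hAc).symm.inter_eq, preimage_empty,
      hμ.innerContent_eq_of_isOpen isOpen_empty, hμ.empty]
  have hae : ∀ᵐ t ∂(stieltjes (restrict μ (g ⁻¹' A)) g), t = c := by
    filter_upwards [measure_eq_zero_iff_ae_notMem.1 hIoi,
      (hμ.restrict hE).ae_le_stieltjes (hμ.restrict_univ_lt_top hfin hE) hg hc] with t htc hct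
    exact le_antisymm (not_lt.1 htc) hct
  rw [integralOver, quasiIntegral, integral_congr_ae hae, integral_const, measureReal_def,
    hμ.stieltjes_restrict_univ hfin hg hE, smul_eq_mul]

theorem setIntegral_nMeasure_of_subset_Iic (hμ : IsDeficientTopologicalMeasure μ)
    (hfin : μ univ < ∞) (hg : Continuous g) {c : ℝ} (hc : ∀ x, c ≤ g x) {A : Set ℝ}
    (hA : IsOpen A ∨ IsClosed A) (hAc : A ⊆ Iic c) :
    ∫ x in g ⁻¹' A, g x ∂(nMeasure μ g) = (stieltjes μ g A).toReal * c := by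
  have hae : ∀ᵐ t ∂(stieltjes μ g), t ∈ A → t = c := by
    filter_upwards [hμ.ae_le_stieltjes hfin hg hc] with t hct htA
    exact le_antisymm (hAc htA) hct
  rw [hμ.setIntegral_nMeasure hfin hg hA,
    setIntegral_congr_ae (measurableSet_of_isOpen_or_isClosed hA) hae, setIntegral_const,
    measureReal_def, smul_eq_mul]

theorem univ_le_of_integralOver_eq [T2Space X] (hμ : IsDeficientTopologicalMeasure μ)
    (hfin : μ univ < ∞) (hg : Continuous g) {c : ℝ} (hc0 : c ≠ 0) (hc : ∀ x, c ≤ g x)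
    (h : integralOver μ g (g ⁻¹' {c}) = ∫ x in g ⁻¹' {c}, g x ∂(nMeasure μ g)) :
    μ univ ≤ μ (g ⁻¹' {c}) + μ (g ⁻¹' Ioi c) := by
  have := hμ.isFiniteMeasure_stieltjes hfin hg
  have hcl : IsClosed (g ⁻¹' {c}) := isClosed_singleton.preimage hg
  have hle : innerContent μ (g ⁻¹' {c}) ≤ μ (g ⁻¹' {c}) := hμ.innerContent_le (.inr hcl) subset_rfl
  rw [hμ.integralOver_preimage_of_subset_Iic hfin hg hc (.inr isClosed_singleton) (by simp),
    hμ.setIntegral_nMeasure_of_subset_Iic hfin hg hc (.inr isClosed_singleton) (by simp)] at h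
  have hpoint : innerContent μ (g ⁻¹' {c}) = stieltjes μ g {c} :=
    (ENNReal.toReal_eq_toReal_iff' (ne_top_of_le_ne_top (hμ.ne_top hfin (.inr hcl)) hle)
      (measure_ne_top _ _)).1 (mul_right_cancel₀ hc0 h)
  calc μ univ = stieltjes μ g univ := (hμ.stieltjes_univ hfin hg).symm
    _ ≤ stieltjes μ g ({c} ∪ Ioi c) := measure_mono_ae <| by
        filter_upwards [hμ.ae_le_stieltjes hfin hg hc] with t ht _
        exact ht.eq_or_lt'
    _ ≤ stieltjes μ g {c} + stieltjes μ g (Ioi c) := measure_union_le _ _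
    _ ≤ μ (g ⁻¹' {c}) + μ (g ⁻¹' Ioi c) := by
        rw [← hpoint, hμ.stieltjes_Ioi hfin hg]
        exact add_le_add_left hle _

theorem isTopologicalMeasure_of_integralOver_eq [T2Space X] [CompactSpace X]
    (hμ : IsDeficientTopologicalMeasure μ) (hfin : μ univ < ∞)
    (h : ∀ g : C(X, ℝ), (∀ x, 0 ≤ g x) → ∀ C : Set ℝ, IsClosed C →
      integralOver μ g (g ⁻¹' C) = ∫ x in g ⁻¹' C, g x ∂(nMeasure μ g)) :
    IsTopologicalMeasure μ := by
  refine hμ.isTopologicalMeasure_of_univ_le hfin fun U hU => ?_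
  have hF := hU.isClosed_compl
  refine ENNReal.le_of_forall_pos_le_add fun ε hε _ => ?_
  obtain ⟨V, hV, hUV, hVε⟩ := hμ.exists_isOpen_lt hF
    (ENNReal.lt_add_right (hμ.ne_top hfin (.inr hF)) (ENNReal.coe_pos.2 hε).ne')
  obtain ⟨f, hfU, hfV, hf⟩ := exists_continuous_zero_one_of_isClosed hF hV.isClosed_compl
    (disjoint_compl_right.mono_left hUV)
  -- `f` is shifted by `1` because an integral over the zero set would carry no information.
  let g : C(X, ℝ) := 1 + f
  have one_le (x : X) : 1 ≤ g x := le_add_of_nonneg_right (hf x).1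
  have hgV : g ⁻¹' {1} ⊆ V := fun x hx => by
    by_contra hxV
    simp [g, hfV hxV] at hx
  have hgU : g ⁻¹' Ioi 1 ⊆ U := fun x hx => by
    by_contra hxU
    simp [g, hfU hxU] at hx
  calc μ univ ≤ μ (g ⁻¹' {1}) + μ (g ⁻¹' Ioi 1) :=
        hμ.univ_le_of_integralOver_eq hfin g.continuous one_ne_zero one_le
          (h g (fun x => zero_le_one.trans (one_le x)) {1} isClosed_singleton)
    _ ≤ μ V + μ U := add_le_add
        (hμ.mono (.inr (isClosed_singleton.preimage g.continuous)) (.inl hV) hgV)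
        (hμ.mono (.inl (isOpen_Ioi.preimage g.continuous)) (.inl hU) hgU)
    _ ≤ μ Uᶜ + ε + μ U := add_le_add_left hVε.le _
    _ = μ U + μ Uᶜ + ε := by ring

end IsDeficientTopologicalMeasure

namespace IsTopologicalMeasure

theorem integralOver_preimage_of_nonneg [T2Space X] (hτ : IsTopologicalMeasure μ)
    (hfin : μ univ < ∞) (hg : Continuous g) (hb : Bornology.IsBounded (range g))
    (h0 : ∀ x, 0 ≤ g x) (hgc : ∀ L ⊆ Ioi 0, IsCompact L → IsCompact (g ⁻¹' L)) {A : Set ℝ}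
    (hA : IsOpen A ∨ IsClosed A) :
    integralOver μ g (g ⁻¹' A) = ∫ x in g ⁻¹' A, g x ∂(nMeasure μ g) := by
  have hμ := hτ.isDeficientTopologicalMeasure
  have hE := isOpen_or_isClosed_preimage hg hA
  have hfinE := hμ.restrict_univ_lt_top hfin hE
  refine le_antisymm (hμ.integralOver_preimage_le hfin hg hb h0 hA) ?_
  rw [hμ.setIntegral_nMeasure hfin hg hA]
  refine integral_id_le_of_measure_Ioi_le (ae_restrict_of_ae (hμ.ae_le_stieltjes hfin hg h0))
    ((hμ.restrict hE).ae_le_stieltjes hfinE hg h0)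
    ((hμ.restrict hE).integrable_id_stieltjes hfinE hg hb) fun t ht => ?_
  rw [Measure.restrict_apply measurableSet_Ioi, hμ.stieltjes_restrict_Ioi hfin hg hE]
  exact (hτ.innerContent_preimage_eq_stieltjes hfin hg
    (measurableSet_Ioi.inter (measurableSet_of_isOpen_or_isClosed hA)) fun L hL =>
      hgc L fun s hs => ht.trans (hL hs).1).ge

theorem stieltjes_restrict_preimage [T2Space X] (hτ : IsTopologicalMeasure μ) (hfin : μ univ < ∞)
    (hg : Continuous g) (hgc : ∀ L, IsCompact L → IsCompact (g ⁻¹' L)) {A : Set ℝ}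
    (hA : IsOpen A ∨ IsClosed A) :
    stieltjes (restrict μ (g ⁻¹' A)) g = (stieltjes μ g).restrict A := by
  have hμ := hτ.isDeficientTopologicalMeasure
  have hE := isOpen_or_isClosed_preimage hg hA
  have hAm := measurableSet_of_isOpen_or_isClosed hA
  have := (hμ.restrict hE).isFiniteMeasure_stieltjes (hμ.restrict_univ_lt_top hfin hE) hg
  have inner_eq {B : Set ℝ} (hB : MeasurableSet B) :
      innerContent μ (g ⁻¹' B) = stieltjes μ g B :=
    hτ.innerContent_preimage_eq_stieltjes hfin hg hB fun L _ => hgc L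
  refine ext_of_generate_finite (range Ioi)
    (BorelSpace.measurable_eq.trans (borel_eq_generateFrom_Ioi ℝ)) isPiSystem_Ioi ?_ ?_
  · rintro _ ⟨t, rfl⟩
    rw [hμ.stieltjes_restrict_Ioi hfin hg hE, ← preimage_inter,
      inner_eq (measurableSet_Ioi.inter hAm), Measure.restrict_apply measurableSet_Ioi]
  · rw [hμ.stieltjes_restrict_univ hfin hg hE, inner_eq hAm, Measure.restrict_apply_univ]

theorem integralOver_preimage [T2Space X] (hτ : IsTopologicalMeasure μ) (hfin : μ univ < ∞)
    (hg : Continuous g) (hgc : ∀ L, IsCompact L → IsCompact (g ⁻¹' L)) {A : Set ℝ}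
    (hA : IsOpen A ∨ IsClosed A) :
    integralOver μ g (g ⁻¹' A) = ∫ x in g ⁻¹' A, g x ∂(nMeasure μ g) := by
  rw [hτ.isDeficientTopologicalMeasure.setIntegral_nMeasure hfin hg hA, integralOver,
    quasiIntegral, hτ.stieltjes_restrict_preimage hfin hg hgc hA]

end IsTopologicalMeasure

theorem isCompact_preimage_of_zero_notMem (g : C₀(X, ℝ)) {L : Set ℝ} (hL : IsClosed L)
    (h0 : 0 ∉ L) : IsCompact (g ⁻¹' L) := by
  obtain ⟨K, hK, hKL⟩ := mem_cocompact.1 (zero_at_infty g (hL.isOpen_compl.mem_nhds h0))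
  exact hK.of_isClosed_subset (hL.preimage (map_continuous g)) fun x hx => by
    by_contra hxK
    exact hKL hxK hx

end

end DTM

open DTM BoundedContinuousFunction in
theorem theorem41_general {X : Type*} [TopologicalSpace X] [T2Space X] (μ : Set X → ℝ≥0∞)
    (hμ : IsDeficientTopologicalMeasure μ) (hfin : μ univ < ∞) :
    (∀ g : X →ᵇ ℝ, (∀ x, 0 ≤ g x) → ∀ A : Set ℝ, IsOpen A ∨ IsClosed A →
      integralOver μ g (g ⁻¹' A) ≤ ∫ x in g ⁻¹' A, g x ∂(nMeasure μ g)) ∧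
    (∀ g : X → ℝ, Continuous g → (∀ x, 0 ≤ g x) → ∀ A : Set ℝ, IsOpen A ∨ IsClosed A →
      A ⊆ Iic 0 → integralOver μ g (g ⁻¹' A) = 0 ∧ ∫ x in g ⁻¹' A, g x ∂(nMeasure μ g) = 0) ∧
    (IsTopologicalMeasure μ → ∀ g : C₀(X, ℝ), (∀ x, 0 ≤ g x) → ∀ A : Set ℝ,
      IsOpen A ∨ IsClosed A →
        integralOver μ g (g ⁻¹' A) = ∫ x in g ⁻¹' A, g x ∂(nMeasure μ g)) ∧
    (CompactSpace X →
      (IsTopologicalMeasure μ → ∀ g : C(X, ℝ), ∀ A : Set ℝ, IsOpen A ∨ IsClosed A →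
        integralOver μ g (g ⁻¹' A) = ∫ x in g ⁻¹' A, g x ∂(nMeasure μ g)) ∧
      (IsTopologicalMeasure μ ↔ ∀ g : C(X, ℝ), (∀ x, 0 ≤ g x) → ∀ C : Set ℝ, IsClosed C →
        integralOver μ g (g ⁻¹' C) = ∫ x in g ⁻¹' C, g x ∂(nMeasure μ g))) := by
  have eq_of_compact [CompactSpace X] (hτ : IsTopologicalMeasure μ) (g : C(X, ℝ)) (A : Set ℝ)
      (hA : IsOpen A ∨ IsClosed A) :
      integralOver μ g (g ⁻¹' A) = ∫ x in g ⁻¹' A, g x ∂(nMeasure μ g) :=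
    hτ.integralOver_preimage hfin g.continuous
      (fun L hL => (hL.isClosed.preimage g.continuous).isCompact) hA
  refine ⟨fun g h0 A hA => ?_, fun g hg h0 A hA hA0 => ⟨?_, ?_⟩, fun hτ g h0 A hA => ?_, fun _ =>
    ⟨eq_of_compact, fun hτ g _ C hC => eq_of_compact hτ g C (.inr hC),
      hμ.isTopologicalMeasure_of_integralOver_eq hfin⟩⟩
  · exact hμ.integralOver_preimage_le hfin g.continuous g.isBounded_range h0 hA
  · rw [hμ.integralOver_preimage_of_subset_Iic hfin hg h0 hA hA0, mul_zero]
  · rw [hμ.setIntegral_nMeasure_of_subset_Iic hfin hg h0 hA hA0, mul_zero]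
  · exact hτ.integralOver_preimage_of_nonneg hfin (map_continuous g) g.toBCF.isBounded_range h0
      (fun L hL hLc => isCompact_preimage_of_zero_notMem g hLc.isClosed
        fun h => lt_irrefl (0 : ℝ) (hL h)) hA

theorem theorem41 {X : Type*} [TopologicalSpace X] [T2Space X] [LocallyCompactSpace X]
    [ConnectedSpace X] (μ : Set X → ℝ≥0∞) (hμ : DTM.IsDeficientTopologicalMeasure μ)
    (hfin : μ univ < ∞) :
    (∀ g : C₀(X, ℝ), (∀ x, 0 ≤ g x) →
      (∀ A : Set ℝ, IsOpen A ∨ IsClosed A →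
        DTM.integralOver μ g (g ⁻¹' A) ≤ ∫ x in g ⁻¹' A, g x ∂(DTM.nMeasure μ g)) ∧
      (DTM.integralOver μ g (g ⁻¹' {0}) = 0 ∧
        (∫ x in g ⁻¹' {0}, g x ∂(DTM.nMeasure μ g)) = 0 ∧
        ∀ A : Set ℝ, IsOpen A ∨ IsClosed A → A ⊆ Iio 0 →
          DTM.integralOver μ g (g ⁻¹' A) = 0 ∧
          (∫ x in g ⁻¹' A, g x ∂(DTM.nMeasure μ g)) = 0) ∧
      (DTM.IsTopologicalMeasure μ → ∀ A : Set ℝ, (IsClosed A ∧ A ⊆ {0}ᶜ) ∨ IsOpen A →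
        DTM.integralOver μ g (g ⁻¹' A) = ∫ x in g ⁻¹' A, g x ∂(DTM.nMeasure μ g))) ∧
    (CompactSpace X →
      (DTM.IsTopologicalMeasure μ → ∀ g : C(X, ℝ), ∀ A : Set ℝ, IsOpen A ∨ IsClosed A →
        DTM.integralOver μ g (g ⁻¹' A) = ∫ x in g ⁻¹' A, g x ∂(DTM.nMeasure μ g)) ∧
      (DTM.IsTopologicalMeasure μ ↔ ∀ g : C(X, ℝ), (∀ x, 0 ≤ g x) → ∀ C : Set ℝ, IsClosed C →
        DTM.integralOver μ g (g ⁻¹' C) = ∫ x in g ⁻¹' C, g x ∂(DTM.nMeasure μ g))) := by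
  obtain ⟨hle, hzero, heq, hcompact⟩ := theorem41_general μ hμ hfin
  exact ⟨fun g h0 => ⟨hle g.toBCF h0, and_assoc.1
    ⟨hzero g (map_continuous g) h0 {0} (.inr isClosed_singleton) (by simp),
      fun A hA hA0 => hzero g (map_continuous g) h0 A hA (hA0.trans Iio_subset_Iic_self)⟩,
    fun hτ A hA => heq hτ g h0 A (hA.symm.imp_right And.left)⟩, hcompact⟩
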